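/- Let $\mathcal H$ be a separable complex Hilbert space, and let $\varphi_T:B(\mathcal H)\to B(\mathcal H)$ be a $w^*$-continuous completely positive linear map with $\varphi_T(I)\le I$, given by a finite or countably infinite family $T=(T_i)_i$ of operators in $B(\mathcal H)$, that is, $\varphi_T(X)=\sum_i T_iXT_i^*$ for all $X\in B(\mathcal H)$, where the sum converges in the $w^*$-topology. Let $V=(V_i)_i$ be the minimal isometric dilation of $T$ on a Hilbert space $\mathcal K\supseteq\mathcal H$: the $V_i\in B(\mathcal K)$ are isometries with pairwise orthogonal ranges, $V_i^*|_{\mathcal H}=T_i^*$ for all $i$, and $\mathcal K$ is the closed linear span of the vectors $V_{i_1}\cdots V_{i_k}h$ with $k\ge 0$ and $h\in\mathcal H$. Let $\varphi_V(Y)=\sum_i V_iYV_i^*$ for $Y\in B(\mathcal K)$, where the sum again converges in the $w^*$-topology, and let $P_{\mathcal H}$ be the orthogonal projection of $\mathcal K$ onto $\mathcal H$. For a positive linear map $\varphi$ on $B(\mathcal H)$ (or on $B(\mathcal K)$), a pure solution of $\varphi(X)\le X$ is an operator $C$ with $\varphi(C)\le C$ and $\varphi^k(C)\to 0$ in the strong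 operator topology as $k\to\infty$. (i) A positive operator $C\in B(\mathcal H)$ satisfies $\varphi_T(C)\le C$ (resp. $\varphi_T(C)=C$) if and only if $C=P_{\mathcal H}D|_{\mathcal H}$ for some positive operator $D\in B(\mathcal K)$ such that $\varphi_V(D)\le D$ (resp. $\varphi_V(D)=D$) and $\|D\|=\|C\|$. (ii) An operator $C\in B(\mathcal H)$ is a pure solution of $\varphi_T(X)\le X$ if and only if $C=P_{\mathcal H}D|_{\mathcal H}$ for some pure solution $D\in B(\mathcal K)$ of $\varphi_V(Y)\le Y$ with $\|D\|=\|C\|$. -/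

import Mathlib

open Filter Topology
open scoped InnerProductSpace CStarAlgebra InnerProduct

/-- The `w*`-topology (ultraweak topology) on `B(H)`: the coarsest topology for which every
functional `A ↦ ∑ₖ ⟪xₖ, A yₖ⟫`, with `∑ₖ ‖xₖ‖² < ∞` and `∑ₖ ‖yₖ‖² < ∞`, is continuous.
(These functionals are exactly the elements of the predual of `B(H)`, and each of these series
converges absolutely.) -/
noncomputable abbrev weakStarTopology (H : Type*) [NormedAddCommGroup H] [InnerProductSpace ℂ H] :
    TopologicalSpace (H →L[ℂ] H) :=
  ⨅ (x : lp (fun _ : ℕ => H) 2) (y : lp (fun _ : ℕ => H) 2),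
    TopologicalSpace.induced (fun A : H →L[ℂ] H => ∑' k : ℕ, ⟪x k, A (y k)⟫_ℂ) inferInstance

/-- Continuity of a map `B(H) → B(H)` for the `w*`-topology on both sides. -/
def IsWeakStarContinuous {H : Type*} [NormedAddCommGroup H] [InnerProductSpace ℂ H]
    (φ : (H →L[ℂ] H) → (H →L[ℂ] H)) : Prop :=
  @Continuous _ _ (weakStarTopology H) (weakStarTopology H) φ

/-- `φ` is the map `φ_A` determined by the family `A`, that is `φ(X) = ∑ᵢ Aᵢ X Aᵢ*` for every
`X ∈ B(H)`, where the sum is the limit of the finite partial sums in the `w*`-topology. -/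
def IsDeterminedBy {H ι : Type*} [NormedAddCommGroup H] [InnerProductSpace ℂ H]
    [CompleteSpace H] (φ : (H →L[ℂ] H) → (H →L[ℂ] H)) (A : ι → (H →L[ℂ] H)) : Prop :=
  ∀ X : H →L[ℂ] H,
    Tendsto (fun s : Finset ι => ∑ i ∈ s, A i ∘L X ∘L (A i)†) atTop
      (@nhds (H →L[ℂ] H) (weakStarTopology H) (φ X))

/-- `C` is a pure solution of `φ(X) ≤ X`: it is a solution (for the Loewner order) and
`φᵏ(C) → 0` in the strong operator topology. -/
def IsPureSolution {H : Type*} [NormedAddCommGroup H] [InnerProductSpace ℂ H]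
    [CompleteSpace H] (φ : (H →L[ℂ] H) → (H →L[ℂ] H)) (C : H →L[ℂ] H) : Prop :=
  φ C ≤ C ∧ ∀ h : H, Tendsto (fun k : ℕ => (φ^[k] C) h) atTop (𝓝 0)

/-- The family `V` on `K` is the minimal isometric dilation of the row `T` on `H`, where `H` is
regarded as a subspace of `K` through the isometric embedding `J`: the `Vᵢ` are isometries with
pairwise orthogonal ranges, `Vᵢ*|_H = Tᵢ*`, and `K` is the closed linear span of the vectors
`V_α h`, where `h ∈ H` and `V_α` is the product of the `Vᵢ` along a finite word `α`. -/
structure IsMinimalIsometricDilation {H K ι : Type*}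
    [NormedAddCommGroup H] [InnerProductSpace ℂ H] [CompleteSpace H]
    [NormedAddCommGroup K] [InnerProductSpace ℂ K] [CompleteSpace K]
    (T : ι → (H →L[ℂ] H)) (J : H →ₗᵢ[ℂ] K) (V : ι → (K →L[ℂ] K)) : Prop where
  norm_map : ∀ i x, ‖V i x‖ = ‖x‖
  orthogonal_ranges : ∀ i j, i ≠ j → ∀ x y, ⟪V i x, V j y⟫_ℂ = 0
  adjoint_map : ∀ i h, ((V i)†) (J h) = J (((T i)†) h)
  minimal : (Submodule.span ℂ
    {y : K | ∃ (α : List ι) (h : H), y = (α.map V).prod (J h)}).topologicalClosure = ⊤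

/-- The compression `P_H D|_H ∈ B(H)` of `D ∈ B(K)`, where `H` is regarded as a subspace of `K`
through the isometric embedding `J`. -/
noncomputable def compression {H K : Type*}
    [NormedAddCommGroup H] [InnerProductSpace ℂ H] [CompleteSpace H]
    [NormedAddCommGroup K] [InnerProductSpace ℂ K] [CompleteSpace K]
    (J : H →ₗᵢ[ℂ] K) (D : K →L[ℂ] K) : H →L[ℂ] H :=
  (J.toContinuousLinearMap)† ∘L D ∘L J.toContinuousLinearMap

/-! The relation `V i* J = J T i*` makes compression intertwine `φV` with `φT`, which settles every
passage from `D` to `C`. For the converses, let K_n be `wordSpan J V n`. These subspaces increase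
from H to a dense union, and each `V i*` maps K_n into K_(n-1) and K_0 into itself, so the form of
`φV D` on K_n depends only on the form of `D` on K_(n-1). A lift can thus be built level by level
from `J C J*`, keeping all operators between 0 and ‖C‖; a weak limit retains the form reached on
each K_n. If `φT C = C`, iterating `φV` already stabilizes on each level. If only `φT C ≤ C`, the
next operator is interpolated between `φV D` and ‖C‖ without changing the form on K_n
(`exists_between_eq_on`, by Douglas factorization). A pure solution dominates its iterates, which
tend to 0, so it is positive and has such a positive lift; the lift is pure because `φV^[k]`
commutes past words in the `V i`. -/

open scoped ComplexOrder

/-! ### Positive operators: order, factorization, interpolation, weak limits. -/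

section Operators

variable {E F G : Type*} [NormedAddCommGroup E] [InnerProductSpace ℂ E]
  [NormedAddCommGroup F] [InnerProductSpace ℂ F] [CompleteSpace F]
  [NormedAddCommGroup G] [InnerProductSpace ℂ G] [CompleteSpace G]

/-- The Loewner order is the pointwise order of quadratic forms. -/
theorem loewner_le_iff {X Y : E →L[ℂ] E} :
    X ≤ Y ↔ ∀ x, ⟪x, X x⟫_ℂ ≤ ⟪x, Y x⟫_ℂ := by
  constructor
  · intro h x
    have := (ContinuousLinearMap.le_def _ _).1 h |>.inner_nonneg_right x
    simpa [inner_sub_right] using this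
  · intro h
    rw [ContinuousLinearMap.le_def, ContinuousLinearMap.isPositive_iff_complex]
    intro x
    have h0 : 0 ≤ ⟪x, (Y - X) x⟫_ℂ := by
      simpa [inner_sub_right] using h x
    have h1 : 0 ≤ ⟪(Y - X) x, x⟫_ℂ := by
      rw [← inner_conj_symm]
      exact star_nonneg_iff.2 h0
    obtain ⟨h2, h3⟩ := Complex.le_def.1 h1
    exact ⟨Complex.ext rfl h3, h2⟩

theorem loewner_nonneg_iff {X : E →L[ℂ] E} : 0 ≤ X ↔ ∀ x, 0 ≤ ⟪x, X x⟫_ℂ := by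
  simp [loewner_le_iff]

theorem loewner_le_of_dense {S : Set E} (hS : Dense S) {X Y : E →L[ℂ] E}
    (h : ∀ x ∈ S, ⟪x, X x⟫_ℂ ≤ ⟪x, Y x⟫_ℂ) : X ≤ Y := by
  rw [loewner_le_iff]
  have hc : IsClosed {x : E | ⟪x, X x⟫_ℂ ≤ ⟪x, Y x⟫_ℂ} :=
    isClosed_le (by fun_prop) (by fun_prop)
  intro x
  exact closure_minimal h hc (hS x)

/-- Douglas factorization: if `‖A x‖ ≤ ‖B x‖` for all `x`, then `A = Z B` with `‖Z‖ ≤ 1`. -/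
theorem exists_contraction_comp_eq {A : E →L[ℂ] F} {B : E →L[ℂ] G}
    (h : ∀ x, ‖A x‖ ≤ ‖B x‖) :
    ∃ Z : G →L[ℂ] F, (∀ y, ‖Z y‖ ≤ ‖y‖) ∧ ∀ x, Z (B x) = A x := by
  let M : Submodule ℂ G := (LinearMap.range B.toLinearMap).topologicalClosure
  have hM : ∀ x, B x ∈ M := fun x =>
    Submodule.le_topologicalClosure _ (LinearMap.mem_range_self B.toLinearMap x)
  let e : E →ₗ[ℂ] M := B.toLinearMap.codRestrict M hM
  have he : DenseRange e := by
    intro y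
    rw [closure_subtype]
    have hy : (y : G) ∈ closure (LinearMap.range B.toLinearMap : Set G) := y.2
    refine closure_mono ?_ hy
    rintro _ ⟨x, rfl⟩
    exact ⟨e x, ⟨x, rfl⟩, rfl⟩
  have hn : ∀ x, ‖A.toLinearMap x‖ ≤ 1 * ‖e x‖ := fun x => by simpa [e] using h x
  let P : G →L[ℂ] M := M.orthogonalProjectionOnto
  -- `Z` extends B x ↦ A x to the closure of the range of `B` and vanishes on the orthogonal
  -- complement.
  refine ⟨(A.toLinearMap.extendOfNorm e).comp P, fun y => ?_, fun x => ?_⟩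
  · calc _ ≤ 1 * ‖P y‖ := A.toLinearMap.norm_extendOfNorm_apply_le he 1 hn _
      _ ≤ ‖y‖ := by
        rw [one_mul]
        exact M.norm_orthogonalProjectionOnto_apply_le y
  · have h1 : P (B x) = e x := M.orthogonalProjectionOnto_mem_subspace_eq_self (e x)
    rw [ContinuousLinearMap.comp_apply, h1]
    exact A.toLinearMap.extendOfNorm_eq he ⟨1, hn⟩ x

theorem tendsto_zero_of_dense_span {A : ℕ → E →L[ℂ] E} {N : ℝ} (hN : ∀ n, ‖A n‖ ≤ N) {S : Set E}
    (hS : (Submodule.span ℂ S).topologicalClosure = ⊤)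
    (h : ∀ x ∈ S, Tendsto (fun n => A n x) atTop (𝓝 0)) (x : E) :
    Tendsto (fun n => A n x) atTop (𝓝 0) := by
  have hspan : ∀ y ∈ Submodule.span ℂ S, Tendsto (fun n => A n y) atTop (𝓝 0) := by
    intro y hy
    induction hy using Submodule.span_induction with
    | mem y hy => exact h y hy
    | zero => simp
    | add y z _ _ hy hz => simpa using hy.add hz
    | smul c y _ hy => simpa using hy.const_smul c
  have hN0 : 0 ≤ N := (norm_nonneg _).trans (hN 0)
  rw [Metric.tendsto_atTop]
  intro ε hε
  have hx : x ∈ closure (Submodule.span ℂ S : Set E) := by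
    rw [← Submodule.topologicalClosure_coe, hS]
    trivial
  obtain ⟨y, hy, hxy⟩ := Metric.mem_closure_iff.1 hx (ε / (2 * (N + 1))) (by positivity)
  obtain ⟨n₀, hn₀⟩ := Metric.tendsto_atTop.1 (hspan y hy) (ε / 2) (by positivity)
  refine ⟨n₀, fun n hn => ?_⟩
  have h1 := hn₀ n hn
  rw [dist_zero_right] at h1 ⊢
  rw [dist_eq_norm] at hxy
  have h2 : ‖A n (x - y)‖ ≤ (N + 1) * ‖x - y‖ :=
    (A n).le_of_opNorm_le ((hN n).trans (by linarith)) _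
  have h3 : (N + 1) * ‖x - y‖ < ε / 2 := by
    have := mul_lt_mul_of_pos_left hxy (show 0 < N + 1 by linarith)
    refine this.trans_eq ?_
    field_simp
  calc ‖A n x‖ = ‖A n (x - y) + A n y‖ := by rw [map_sub, sub_add_cancel]
    _ ≤ ‖A n (x - y)‖ + ‖A n y‖ := norm_add_le _ _
    _ < ε := by linarith

variable [CompleteSpace E]

theorem inner_sqrt_sqrt {R : E →L[ℂ] E} (hR : 0 ≤ R) (x y : E) :
    ⟪CFC.sqrt R x, CFC.sqrt R y⟫_ℂ = ⟪x, R y⟫_ℂ := by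
  have hs : IsSelfAdjoint (CFC.sqrt R) := (CFC.sqrt_nonneg R).isSelfAdjoint
  rw [← ContinuousLinearMap.adjoint_inner_right, hs.adjoint_eq, ← mul_apply_eq_comp,
    CFC.sqrt_mul_sqrt_self R hR]

theorem norm_sqrt_apply_sq {R : E →L[ℂ] E} (hR : 0 ≤ R) (x : E) :
    ((‖CFC.sqrt R x‖ : ℂ)) ^ 2 = ⟪x, R x⟫_ℂ := by
  rw [← inner_sqrt_sqrt hR, inner_self_eq_norm_sq_to_K]
  rfl

theorem norm_sqrt_apply_le {R : E →L[ℂ] E} {S : F →L[ℂ] F} (hR : 0 ≤ R) (hS : 0 ≤ S) {x : E}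
    {y : F} (h : ⟪x, R x⟫_ℂ ≤ ⟪y, S y⟫_ℂ) : ‖CFC.sqrt R x‖ ≤ ‖CFC.sqrt S y‖ := by
  rw [← norm_sqrt_apply_sq hR, ← norm_sqrt_apply_sq hS] at h
  exact (sq_le_sq₀ (norm_nonneg _) (norm_nonneg _)).1 (by exact_mod_cast h)

/-- A positive operator below a compression of `R ≥ 0` is the compression of a positive operator
below `R`. -/
theorem exists_le_of_le_compression {R : F →L[ℂ] F} {Δ : E →L[ℂ] E} (J : E →L[ℂ] F)
    (hR : 0 ≤ R) (hΔ : 0 ≤ Δ) (h : ∀ x, ⟪x, Δ x⟫_ℂ ≤ ⟪J x, R (J x)⟫_ℂ) :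
    ∃ S : F →L[ℂ] F, 0 ≤ S ∧ S ≤ R ∧ ∀ x, ⟪J x, S (J x)⟫_ℂ = ⟪x, Δ x⟫_ℂ := by
  obtain ⟨Z, hZ, hZ'⟩ := exists_contraction_comp_eq (A := CFC.sqrt Δ) (B := (CFC.sqrt R) ∘L J)
    (fun x => norm_sqrt_apply_le hΔ hR (h x))
  have hform : ∀ y, ⟪y, (((Z ∘L CFC.sqrt R)†) ∘L (Z ∘L CFC.sqrt R)) y⟫_ℂ
      = (‖Z (CFC.sqrt R y)‖ : ℂ) ^ 2 := fun y => by
    rw [ContinuousLinearMap.comp_apply, ContinuousLinearMap.adjoint_inner_right,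
      inner_self_eq_norm_sq_to_K]
    rfl
  -- With Z √R J = √Δ and ‖Z‖ ≤ 1, the operator √R Z* Z √R lies below `R` and compresses to `Δ`.
  refine ⟨((Z ∘L CFC.sqrt R)†) ∘L (Z ∘L CFC.sqrt R), ?_, ?_, fun x => ?_⟩
  · rw [loewner_nonneg_iff]
    intro y
    rw [hform]
    exact_mod_cast sq_nonneg ‖Z (CFC.sqrt R y)‖
  · rw [loewner_le_iff]
    intro y
    rw [hform, ← norm_sqrt_apply_sq hR]
    exact_mod_cast pow_le_pow_left₀ (norm_nonneg _) (hZ _) 2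
  · rw [hform, ← norm_sqrt_apply_sq hΔ, ← hZ' x]
    rfl

/-- If `B ≤ R`, `D ≤ R`, and the form of `B` is below that of `D` on a closed subspace `M`, then some
operator between `B` and `R` has the same form as `D` on `M`. -/
theorem exists_between_eq_on {B D R : E →L[ℂ] E} (M : Submodule ℂ E) (hM : IsClosed (M : Set E))
    (hBR : B ≤ R) (hB : ∀ x ∈ M, ⟪x, B x⟫_ℂ ≤ ⟪x, D x⟫_ℂ) (hDR : D ≤ R) :
    ∃ D' : E →L[ℂ] E, B ≤ D' ∧ D' ≤ R ∧ ∀ x ∈ M, ⟪x, D' x⟫_ℂ = ⟪x, D x⟫_ℂ := by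
  have : CompleteSpace M := hM.completeSpace_coe
  have hform : ∀ x : M, ⟪x, ((M.subtypeL†) ∘L (D - B) ∘L M.subtypeL) x⟫_ℂ
      = ⟪(x : E), D x⟫_ℂ - ⟪(x : E), B x⟫_ℂ := fun x => by
    rw [ContinuousLinearMap.comp_apply, ContinuousLinearMap.adjoint_inner_right]
    simp [inner_sub_right]
  -- After subtracting `B`, the compression of `D - B` to `M` is lifted to some 0 ≤ S ≤ R - B; then
  -- `D' = B + S`.
  obtain ⟨S, hS0, hSR, hS⟩ := exists_le_of_le_compression (R := R - B)
    (Δ := (M.subtypeL†) ∘L (D - B) ∘L M.subtypeL) M.subtypeL (sub_nonneg.2 hBR)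
    (by
      rw [loewner_nonneg_iff]
      intro x
      rw [hform, sub_nonneg]
      exact hB x x.2)
    (fun x => by
      rw [hform]
      have := loewner_le_iff.1 hDR x
      simpa [inner_sub_right] using this)
  refine ⟨B + S, by simpa using hS0, by simpa [add_comm] using le_sub_iff_add_le.1 hSR,
    fun x hx => ?_⟩
  have := hS ⟨x, hx⟩
  rw [hform] at this
  simp only [Submodule.subtypeL_apply] at this
  rw [add_apply, inner_add_right, this]
  ring

/-- Bounded sequences of operators have limits in the weak operator topology along an
ultrafilter. -/
theorem exists_weak_limit (U : Ultrafilter ℕ) (D : ℕ → E →L[ℂ] E) {N : ℝ}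
    (hD : ∀ n, ‖D n‖ ≤ N) :
    ∃ L : E →L[ℂ] E, ∀ x y, Tendsto (fun n => ⟪x, D n y⟫_ℂ) U (𝓝 ⟪x, L y⟫_ℂ) := by
  have hb : ∀ x y n, ‖⟪D n x, y⟫_ℂ‖ ≤ N * ‖x‖ * ‖y‖ := fun x y n =>
    (norm_inner_le_norm _ _).trans
      (mul_le_mul_of_nonneg_right ((D n).le_of_opNorm_le (hD n) x) (norm_nonneg y))
  have hex : ∀ x y, ∃ l : ℂ, ‖l‖ ≤ N * ‖x‖ * ‖y‖ ∧ Tendsto (fun n => ⟪D n x, y⟫_ℂ) U (𝓝 l) := by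
    intro x y
    obtain ⟨l, hl, hl'⟩ := (isCompact_closedBall (0 : ℂ) (N * ‖x‖ * ‖y‖)).ultrafilter_le_nhds
      (U.map fun n => ⟪D n x, y⟫_ℂ) (by
        rw [le_principal_iff]
        exact Filter.mem_map.2 (Filter.univ_mem' fun n => by simpa using hb x y n))
    exact ⟨l, by simpa using hl, hl'⟩
  choose l hl hlim using hex
  let B : E →ₗ⋆[ℂ] E →ₗ[ℂ] ℂ := LinearMap.mk₂'ₛₗ _ _ l
    (fun x x' y => tendsto_nhds_unique (hlim _ _)
      (((hlim x y).add (hlim x' y)).congr fun n => by rw [map_add, inner_add_left]))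
    (fun c x y => tendsto_nhds_unique (hlim _ _)
      (((hlim x y).const_mul (star c)).congr fun n => by
        rw [map_smul, inner_smul_left]; rfl))
    (fun x y y' => tendsto_nhds_unique (hlim _ _)
      (((hlim x y).add (hlim x y')).congr fun n => by rw [inner_add_right]))
    (fun c x y => tendsto_nhds_unique (hlim _ _)
      (((hlim x y).const_mul c).congr fun n => by rw [inner_smul_right]))
  refine ⟨InnerProductSpace.continuousLinearMapOfBilin (B.mkContinuous₂ N hl), fun x y => ?_⟩
  rw [← inner_conj_symm, InnerProductSpace.continuousLinearMapOfBilin_apply]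
  refine ((Complex.continuous_conj.tendsto _).comp (hlim y x)).congr fun n => ?_
  exact inner_conj_symm _ _

/-- For A ≥ 0, factoring A = √A √A gives ‖A x‖² ≤ ‖A‖ ⟪x, A x⟫. -/
theorem tendsto_apply_zero_of_tendsto_inner_self {A : ℕ → E →L[ℂ] E} {N : ℝ} (hA : ∀ n, 0 ≤ A n)
    (hN : ∀ n, ‖A n‖ ≤ N) {x : E} (h : Tendsto (fun n => ⟪x, A n x⟫_ℂ) atTop (𝓝 0)) :
    Tendsto (fun n => A n x) atTop (𝓝 0) := by
  have h1 : ∀ n, ‖CFC.sqrt (A n) x‖ ^ 2 = ‖⟪x, A n x⟫_ℂ‖ := fun n => by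
    rw [← norm_sqrt_apply_sq (hA n)]
    simp
  have h2 : ∀ n, ‖A n x‖ ^ 2 ≤ N * ‖⟪x, A n x⟫_ℂ‖ := fun n => by
    have h3 : A n x = CFC.sqrt (A n) (CFC.sqrt (A n) x) := by
      rw [← mul_apply_eq_comp, CFC.sqrt_mul_sqrt_self _ (hA n)]
    have h4 : ‖CFC.sqrt (A n)‖ ^ 2 ≤ N := by
      refine le_trans (le_of_eq ?_) (hN n)
      rw [sq, ← CStarRing.norm_self_mul_star (x := CFC.sqrt (A n)),
        (CFC.sqrt_nonneg (A n)).isSelfAdjoint.star_eq, CFC.sqrt_mul_sqrt_self _ (hA n)]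
    rw [← h1, h3]
    calc _ ≤ (‖CFC.sqrt (A n)‖ * ‖CFC.sqrt (A n) x‖) ^ 2 :=
          pow_le_pow_left₀ (norm_nonneg _) (ContinuousLinearMap.le_opNorm _ _) 2
      _ = ‖CFC.sqrt (A n)‖ ^ 2 * ‖CFC.sqrt (A n) x‖ ^ 2 := mul_pow _ _ _
      _ ≤ _ := by gcongr
  have h5 : Tendsto (fun n => ‖A n x‖ ^ 2) atTop (𝓝 0) := by
    refine squeeze_zero (fun n => sq_nonneg _) h2 ?_
    simpa using h.norm.const_mul N
  rw [tendsto_zero_iff_norm_tendsto_zero]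
  have := h5.sqrt
  simpa using this

end Operators

/-! ### Maps given by weak-* sums ∑ A_i X A_i*. -/

section DeterminedMaps

variable {E ι : Type*} [NormedAddCommGroup E] [InnerProductSpace ℂ E] [CompleteSpace E]
  {φ : (E →L[ℂ] E) → (E →L[ℂ] E)} {A : ι → (E →L[ℂ] E)}

/-- Sequences supported at index 0 show that the functionals ⟪x, · y⟫ are weak-* continuous;
everything later uses only these scalar sums. -/
theorem IsDeterminedBy.hasSum (h : IsDeterminedBy φ A) (X : E →L[ℂ] E) (x y : E) :
    HasSum (fun i => ⟪((A i)†) x, X (((A i)†) y)⟫_ℂ) ⟪x, φ X y⟫_ℂ := by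
  let u : lp (fun _ : ℕ => E) 2 := lp.single 2 0 x
  let v : lp (fun _ : ℕ => E) 2 := lp.single 2 0 y
  have hf : ∀ B : E →L[ℂ] E, ∑' k : ℕ, ⟪u k, B (v k)⟫_ℂ = ⟪x, B y⟫_ℂ := fun B => by
    rw [tsum_eq_single 0]
    · simp [u, v]
    · intro k hk
      simp [u, v, hk]
  have hc : @Continuous _ _ (weakStarTopology E) _ (fun B : E →L[ℂ] E => ⟪x, B y⟫_ℂ) := by
    simp_rw [← hf]
    exact continuous_iff_le_induced.2 ((iInf_le _ u).trans (iInf_le _ v))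
  have := ((@Continuous.tendsto _ _ (weakStarTopology E) _ _ hc (φ X)).comp (h X))
  refine this.congr fun s => ?_
  simp [Function.comp_apply, sum_apply, ContinuousLinearMap.adjoint_inner_left]

theorem IsDeterminedBy.monotone (h : IsDeterminedBy φ A) : Monotone φ := fun X Y hXY =>
  loewner_le_iff.2 fun x =>
    hasSum_le (fun i => loewner_le_iff.1 hXY (((A i)†) x)) (h.hasSum X x x) (h.hasSum Y x x)

theorem IsDeterminedBy.inner_self_eq (h : IsDeterminedBy φ A) {X Y : E →L[ℂ] E} {x : E}
    (hx : ∀ i, ⟪((A i)†) x, X (((A i)†) x)⟫_ℂ = ⟪((A i)†) x, Y (((A i)†) x)⟫_ℂ) :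
    ⟪x, φ X x⟫_ℂ = ⟪x, φ Y x⟫_ℂ := by
  refine (h.hasSum X x x).unique ?_
  simp_rw [hx]
  exact h.hasSum Y x x

theorem IsDeterminedBy.map_nonneg (h : IsDeterminedBy φ A) {X : E →L[ℂ] E} (hX : 0 ≤ X) :
    0 ≤ φ X :=
  loewner_nonneg_iff.2 fun x =>
    (h.hasSum X x x).nonneg fun _ => loewner_nonneg_iff.1 hX _

theorem IsDeterminedBy.iterate_nonneg (h : IsDeterminedBy φ A) {X : E →L[ℂ] E} (hX : 0 ≤ X)
    (k : ℕ) : 0 ≤ φ^[k] X := by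
  induction k with
  | zero => exact hX
  | succ k ih =>
    rw [Function.iterate_succ_apply']
    exact h.map_nonneg ih

end DeterminedMaps

/-! ### The filtration of the dilation space by word length. -/

section Dilation

variable {H K ι : Type*} [NormedAddCommGroup H] [InnerProductSpace ℂ H] [CompleteSpace H]
  [NormedAddCommGroup K] [InnerProductSpace ℂ K] [CompleteSpace K]
  {T : ι → (H →L[ℂ] H)} {J : H →ₗᵢ[ℂ] K} {V : ι → (K →L[ℂ] K)}
  {φT : (H →L[ℂ] H) → (H →L[ℂ] H)} {φV : (K →L[ℂ] K) → (K →L[ℂ] K)}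

theorem inner_compression (D : K →L[ℂ] K) (x y : H) :
    ⟪x, compression J D y⟫_ℂ = ⟪J x, D (J y)⟫_ℂ := by
  simp [compression, ContinuousLinearMap.adjoint_inner_right]

theorem norm_compression_le (D : K →L[ℂ] K) : ‖compression J D‖ ≤ ‖D‖ := by
  have h : ‖J.toContinuousLinearMap‖ ≤ 1 := J.norm_toContinuousLinearMap_le
  calc _ ≤ ‖(J.toContinuousLinearMap)†‖ * (‖D‖ * ‖J.toContinuousLinearMap‖) :=
        (ContinuousLinearMap.opNorm_comp_le _ _).trans
          (mul_le_mul_of_nonneg_left (ContinuousLinearMap.opNorm_comp_le _ _) (norm_nonneg _))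
    _ ≤ 1 * (‖D‖ * 1) := by
        rw [LinearIsometryEquiv.norm_map]
        gcongr
    _ = ‖D‖ := by ring

theorem compression_mono : Monotone (compression J) := fun D D' h =>
  loewner_le_iff.2 fun x => by
    simpa only [inner_compression] using loewner_le_iff.1 h (J x)

/-- The closed span of the vectors `V_α h` with `h ∈ H` and `α` a word of length at most `n`. -/
noncomputable def wordSpan (J : H →ₗᵢ[ℂ] K) (V : ι → (K →L[ℂ] K)) (n : ℕ) : Submodule ℂ K :=
  (Submodule.span ℂ {y : K | ∃ (α : List ι) (h : H), α.length ≤ n ∧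
    y = (α.map V).prod (J h)}).topologicalClosure

theorem isClosed_wordSpan (n : ℕ) : IsClosed (wordSpan J V n : Set K) :=
  Submodule.isClosed_topologicalClosure _

theorem wordSpan_mono : Monotone (wordSpan J V) := fun _ _ hmn =>
  Submodule.topologicalClosure_mono (Submodule.span_mono
    fun _ ⟨α, h, hα, hy⟩ => ⟨α, h, hα.trans hmn, hy⟩)

theorem mem_wordSpan (α : List ι) (h : H) : (α.map V).prod (J h) ∈ wordSpan J V α.length :=
  Submodule.le_topologicalClosure _ (Submodule.subset_span ⟨α, h, le_rfl, rfl⟩)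

theorem wordSpan_zero_subset_range : (wordSpan J V 0 : Set K) ⊆ Set.range J := by
  have : wordSpan J V 0 ≤ LinearMap.range J.toLinearMap := by
    refine Submodule.topologicalClosure_minimal _ (Submodule.span_le.2 ?_)
      J.isometry.isClosedEmbedding.isClosed_range
    rintro _ ⟨α, h, hα, rfl⟩
    rw [List.length_eq_zero_iff.1 (Nat.le_zero.1 hα)]
    exact ⟨h, by simp⟩
  exact this

namespace IsMinimalIsometricDilation

variable (hV : IsMinimalIsometricDilation T J V)
include hV

theorem adjoint_apply_self (i : ι) (x : K) : ((V i)†) (V i x) = x := by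
  have h := (ContinuousLinearMap.norm_map_iff_adjoint_comp_self (V i)).1 (hV.norm_map i)
  exact DFunLike.congr_fun h x

theorem adjoint_apply_of_ne {i j : ι} (hij : i ≠ j) (x : K) : ((V i)†) (V j x) = 0 := by
  refine ext_inner_left ℂ fun y => ?_
  rw [ContinuousLinearMap.adjoint_inner_right, hV.orthogonal_ranges i j hij, inner_zero_right]

/-- `V i*` strips the first letter of a word or kills the vector. On the empty word it acts as `T
i*` and stays in H, so truncated `n - 1` is correct at `n = 0`. -/
theorem adjoint_mem_wordSpan (n : ℕ) (i : ι) {x : K} (hx : x ∈ wordSpan J V n) :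
    ((V i)†) x ∈ wordSpan J V (n - 1) := by
  have : wordSpan J V n ≤ (wordSpan J V (n - 1)).comap ((V i)†).toLinearMap := by
    refine Submodule.topologicalClosure_minimal _ (Submodule.span_le.2 ?_)
      ((isClosed_wordSpan _).preimage ((V i)†).continuous)
    rintro _ ⟨α, h, hα, rfl⟩
    change ((V i)†) _ ∈ wordSpan J V (n - 1)
    cases α with
    | nil =>
      simp only [List.map_nil, List.prod_nil, one_apply_eq_self, hV.adjoint_map]
      exact wordSpan_mono (Nat.zero_le _) (mem_wordSpan (V := V) [] _)
    | cons j β =>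
      rw [List.map_cons, List.prod_cons, mul_apply_eq_comp]
      by_cases hij : i = j
      · subst hij
        rw [hV.adjoint_apply_self]
        refine wordSpan_mono ?_ (mem_wordSpan β h)
        simp only [List.length_cons] at hα
        omega
      · rw [hV.adjoint_apply_of_ne hij]
        exact Submodule.zero_mem _
  exact this hx

theorem dense_iUnion_wordSpan : Dense (⋃ n, (wordSpan J V n : Set K)) := by
  have h1 : (Submodule.span ℂ {y : K | ∃ (α : List ι) (h : H), y = (α.map V).prod (J h)} : Set K)
      ⊆ ⋃ n, (wordSpan J V n : Set K) := by
    rw [← Submodule.coe_iSup_of_directed _ wordSpan_mono.directed_le]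
    refine SetLike.coe_subset_coe.2 (Submodule.span_le.2 ?_)
    rintro _ ⟨α, h, rfl⟩
    exact le_iSup (wordSpan J V) _ (mem_wordSpan α h)
  refine Dense.mono h1 ?_
  rw [dense_iff_closure_eq, ← Submodule.topologicalClosure_coe, hV.minimal]
  rfl

theorem compression_map (hT : IsDeterminedBy φT T) (hφV : IsDeterminedBy φV V) (D : K →L[ℂ] K) :
    compression J (φV D) = φT (compression J D) := by
  ext y
  refine ext_inner_left ℂ fun x => ?_
  rw [inner_compression]
  refine (hφV.hasSum D (J x) (J y)).unique ?_
  simp_rw [hV.adjoint_map, ← inner_compression]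
  exact hT.hasSum _ x y

theorem compression_iterate (hT : IsDeterminedBy φT T) (hφV : IsDeterminedBy φV V)
    (D : K →L[ℂ] K) (k : ℕ) : compression J (φV^[k] D) = φT^[k] (compression J D) := by
  induction k with
  | zero => rfl
  | succ k ih =>
    rw [Function.iterate_succ_apply', Function.iterate_succ_apply', hV.compression_map hT hφV, ih]

theorem map_apply_apply (hφV : IsDeterminedBy φV V) (D : K →L[ℂ] K) (j : ι) (x : K) :
    φV D (V j x) = V j (D x) := by
  refine ext_inner_left ℂ fun y => ?_
  refine (hφV.hasSum D y (V j x)).unique ?_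
  rw [← ContinuousLinearMap.adjoint_inner_left]
  convert hasSum_single j fun i hij => ?_ using 1
  · rw [hV.adjoint_apply_self]
  · rw [hV.adjoint_apply_of_ne hij, map_zero, inner_zero_right]

/-- `φV 1` is the sum of the range projections of the `V i`, hence a projection: from `φV 1` V_i =
V_i one gets V_i* `φV 1` = V_i*, and so idempotence. -/
theorem map_one_le_one (hφV : IsDeterminedBy φV V) : φV 1 ≤ 1 := by
  have h0 : 0 ≤ φV 1 := hφV.map_nonneg zero_le_one
  have hsa : (φV 1)† = φV 1 := h0.isSelfAdjoint
  have hadj : ∀ i y, ((V i)†) (φV 1 y) = ((V i)†) y := fun i y => by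
    refine ext_inner_left ℂ fun z => ?_
    rw [ContinuousLinearMap.adjoint_inner_right, ← ContinuousLinearMap.adjoint_inner_left, hsa,
      hV.map_apply_apply hφV, ContinuousLinearMap.adjoint_inner_right, one_apply_eq_self]
  have hidem : IsIdempotentElem (φV 1) := by
    ext y
    refine ext_inner_left ℂ fun x => ?_
    refine (hφV.hasSum 1 x (φV 1 y)).unique ?_
    simp_rw [hadj]
    exact hφV.hasSum 1 x y
  exact (IsStarProjection.mk hidem h0.isSelfAdjoint).le_one

end IsMinimalIsometricDilation

end Dilation

/-! ### Scalar bounds and extension by zero. -/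

theorem inner_algebraMap_apply_self {E : Type*} [NormedAddCommGroup E] [InnerProductSpace ℂ E]
    (N : ℝ) (x : E) :
    ⟪x, (algebraMap ℝ (E →L[ℂ] E) N) x⟫_ℂ = N * ⟪x, x⟫_ℂ := by
  rw [Algebra.algebraMap_eq_smul_one, smul_apply, one_apply_eq_self,
    inner_smul_right_eq_smul, Complex.real_smul]

theorem opNorm_le_iff_le_algebraMap {E : Type*} [NormedAddCommGroup E] [InnerProductSpace ℂ E]
    [CompleteSpace E] {X : E →L[ℂ] E} (hX : 0 ≤ X) {N : ℝ} (hN : 0 ≤ N) :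
    ‖X‖ ≤ N ↔ X ≤ algebraMap ℝ (E →L[ℂ] E) N :=
  CStarAlgebra.norm_le_iff_le_algebraMap X hN hX

section Ampliation

variable {H K : Type*} [NormedAddCommGroup H] [InnerProductSpace ℂ H] [CompleteSpace H]
  [NormedAddCommGroup K] [InnerProductSpace ℂ K] [CompleteSpace K]

/-- The extension `J C J*` of an operator by zero. -/
noncomputable def extendByZero (J : H →ₗᵢ[ℂ] K) (C : H →L[ℂ] H) : K →L[ℂ] K :=
  J.toContinuousLinearMap ∘L C ∘L (J.toContinuousLinearMap)†

variable (J : H →ₗᵢ[ℂ] K)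

theorem adjoint_toContinuousLinearMap_apply_self (x : H) :
    ((J.toContinuousLinearMap)†) (J x) = x := by
  refine ext_inner_left ℂ fun y => ?_
  rw [ContinuousLinearMap.adjoint_inner_right]
  exact J.inner_map_map y x

theorem inner_extendByZero (C : H →L[ℂ] H) (x y : K) :
    ⟪x, extendByZero J C y⟫_ℂ
      = ⟪((J.toContinuousLinearMap)†) x, C (((J.toContinuousLinearMap)†) y)⟫_ℂ := by
  rw [ContinuousLinearMap.adjoint_inner_left]
  rfl

theorem compression_extendByZero (C : H →L[ℂ] H) : compression J (extendByZero J C) = C := by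
  ext y
  refine ext_inner_left ℂ fun x => ?_
  rw [inner_compression, inner_extendByZero, adjoint_toContinuousLinearMap_apply_self,
    adjoint_toContinuousLinearMap_apply_self]

variable {J}

theorem extendByZero_nonneg {C : H →L[ℂ] H} (hC : 0 ≤ C) : 0 ≤ extendByZero J C := by
  rw [loewner_nonneg_iff]
  intro x
  rw [inner_extendByZero]
  exact loewner_nonneg_iff.1 hC _

theorem extendByZero_le_algebraMap {C : H →L[ℂ] H} (hC : 0 ≤ C) :
    extendByZero J C ≤ algebraMap ℝ (K →L[ℂ] K) ‖C‖ := by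
  refine (opNorm_le_iff_le_algebraMap (extendByZero_nonneg hC) (norm_nonneg C)).1 ?_
  have h : ‖J.toContinuousLinearMap‖ ≤ 1 := J.norm_toContinuousLinearMap_le
  calc _ ≤ ‖J.toContinuousLinearMap‖ * (‖C‖ * ‖(J.toContinuousLinearMap)†‖) :=
        (ContinuousLinearMap.opNorm_comp_le _ _).trans
          (mul_le_mul_of_nonneg_left (ContinuousLinearMap.opNorm_comp_le _ _) (norm_nonneg _))
    _ ≤ 1 * (‖C‖ * 1) := by
        rw [LinearIsometryEquiv.norm_map]
        gcongr
    _ = ‖C‖ := by ring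

end Ampliation

/-! ### Lifting solutions from H to K. -/

namespace IsMinimalIsometricDilation

variable {H K ι : Type*} [NormedAddCommGroup H] [InnerProductSpace ℂ H] [CompleteSpace H]
  [NormedAddCommGroup K] [InnerProductSpace ℂ K] [CompleteSpace K]
  {T : ι → (H →L[ℂ] H)} {J : H →ₗᵢ[ℂ] K} {V : ι → (K →L[ℂ] K)}
  {φT : (H →L[ℂ] H) → (H →L[ℂ] H)} {φV : (K →L[ℂ] K) → (K →L[ℂ] K)}

/-- A bounded sequence of positive operators whose compressions to the subspaces `wordSpan J V n`
stabilize has a limit with these compressions. -/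
theorem exists_limit_of_eq_on_wordSpan {D : ℕ → K →L[ℂ] K} {N : ℝ} (hN : 0 ≤ N)
    (h0 : ∀ n, 0 ≤ D n) (hD : ∀ n, D n ≤ algebraMap ℝ (K →L[ℂ] K) N)
    (h : ∀ n, ∀ x ∈ wordSpan J V n, ⟪x, D (n + 1) x⟫_ℂ = ⟪x, D n x⟫_ℂ) :
    ∃ L : K →L[ℂ] K, 0 ≤ L ∧ L ≤ algebraMap ℝ (K →L[ℂ] K) N ∧
      ∀ n, ∀ x ∈ wordSpan J V n, ⟪x, L x⟫_ℂ = ⟪x, D n x⟫_ℂ := by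
  have hnorm : ∀ n, ‖D n‖ ≤ N := fun n =>
    (opNorm_le_iff_le_algebraMap (h0 n) hN).2 (hD n)
  -- A free ultrafilter supplies weak compactness; its choice does not affect the forms on the
  -- levels, where the sequence is eventually constant.
  obtain ⟨L, hL⟩ := exists_weak_limit (hyperfilter ℕ) D hnorm
  refine ⟨L, loewner_nonneg_iff.2 fun x => ?_, loewner_le_iff.2 fun x => ?_, fun n x hx => ?_⟩
  · exact ge_of_tendsto' (hL x x) fun n => loewner_nonneg_iff.1 (h0 n) x
  · exact le_of_tendsto' (hL x x) fun n => loewner_le_iff.1 (hD n) x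
  · have hev : ∀ m, n ≤ m → ⟪x, D m x⟫_ℂ = ⟪x, D n x⟫_ℂ := fun m hm => by
      induction m, hm using Nat.le_induction with
      | base => rfl
      | succ m hm ih => rw [h m x (wordSpan_mono hm hx), ih]
    have hle : (hyperfilter ℕ : Filter ℕ) ≤ atTop := by
      rw [← Nat.cofinite_eq_atTop]
      exact hyperfilter_le_cofinite
    refine tendsto_nhds_unique (hL x x) ?_
    refine Tendsto.congr' ?_ tendsto_const_nhds
    filter_upwards [hle (eventually_ge_atTop n)] with m hm
    exact (hev m hm).symm

theorem eq_compression_of_eq_on_wordSpan {C : H →L[ℂ] H} {D : K →L[ℂ] K}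
    (h : ∀ x ∈ wordSpan J V 0,
      ⟪x, D x⟫_ℂ = ⟪x, extendByZero J C x⟫_ℂ) :
    C = compression J D := by
  have hq : ∀ x, ⟪x, C x⟫_ℂ = ⟪x, compression J D x⟫_ℂ := fun x => by
    rw [inner_compression, h (J x) (by simpa using mem_wordSpan (J := J) (V := V) [] x),
      ← inner_compression, compression_extendByZero]
  exact le_antisymm (loewner_le_iff.2 fun x => (hq x).le) (loewner_le_iff.2 fun x => (hq x).ge)

variable (hV : IsMinimalIsometricDilation T J V)
include hV

theorem map_le_algebraMap (hφV : IsDeterminedBy φV V) {N : ℝ} (hN : 0 ≤ N) {X : K →L[ℂ] K}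
    (hX : X ≤ algebraMap ℝ (K →L[ℂ] K) N) : φV X ≤ algebraMap ℝ (K →L[ℂ] K) N := by
  rw [loewner_le_iff]
  intro x
  have hN' : (0 : ℂ) ≤ N := by exact_mod_cast hN
  have h1 := hasSum_le (fun i => ?_) (hφV.hasSum X x x) ((hφV.hasSum 1 x x).mul_left (N : ℂ))
  · rw [inner_algebraMap_apply_self]
    exact h1.trans
      (mul_le_mul_of_nonneg_left (loewner_le_iff.1 (hV.map_one_le_one hφV) x) hN')
  · rw [one_apply_eq_self, ← inner_algebraMap_apply_self]
    exact loewner_le_iff.1 hX _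

theorem inner_map_eq_of_eq_on_wordSpan (hφV : IsDeterminedBy φV V) {n : ℕ} {D D' : K →L[ℂ] K}
    (h : ∀ x ∈ wordSpan J V (n - 1), ⟪x, D x⟫_ℂ = ⟪x, D' x⟫_ℂ) :
    ∀ x ∈ wordSpan J V n, ⟪x, φV D x⟫_ℂ = ⟪x, φV D' x⟫_ℂ := fun _ hx =>
  hφV.inner_self_eq fun i => h _ (hV.adjoint_mem_wordSpan n i hx)

theorem le_of_le_on_wordSpan {X Y : K →L[ℂ] K}
    (h : ∀ n, ∀ x ∈ wordSpan J V n, ⟪x, X x⟫_ℂ ≤ ⟪x, Y x⟫_ℂ) : X ≤ Y := by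
  refine loewner_le_of_dense hV.dense_iUnion_wordSpan fun x hx => ?_
  obtain ⟨n, hn⟩ := Set.mem_iUnion.1 hx
  exact h n x hn

/-- The iterates of `φV` on `J C J*` work: step 1 preserves the form on K_0 because `φT C = C`, and
each application of `φV` carries agreement one level up. -/
theorem exists_fixed_of_fixed (hT : IsDeterminedBy φT T) (hφV : IsDeterminedBy φV V)
    {C : H →L[ℂ] H} (hC0 : 0 ≤ C) (hC : φT C = C) :
    ∃ D : K →L[ℂ] K, 0 ≤ D ∧ φV D = D ∧ C = compression J D ∧ ‖C‖ = ‖D‖ := by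
  let D : ℕ → K →L[ℂ] K := fun n => φV^[n] (extendByZero J C)
  have hsucc : ∀ n, D (n + 1) = φV (D n) := fun n => Function.iterate_succ_apply' _ _ _
  have h0 : ∀ n, 0 ≤ D n := hφV.iterate_nonneg (extendByZero_nonneg hC0)
  have hN : ∀ n, D n ≤ algebraMap ℝ (K →L[ℂ] K) ‖C‖ := fun n => by
    induction n with
    | zero => exact extendByZero_le_algebraMap hC0
    | succ n ih =>
      rw [hsucc]
      exact hV.map_le_algebraMap hφV (norm_nonneg C) ih
  have hagree : ∀ n, ∀ x ∈ wordSpan J V n, ⟪x, D (n + 1) x⟫_ℂ = ⟪x, D n x⟫_ℂ := fun n => by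
    induction n with
    | zero =>
      intro x hx
      obtain ⟨y, rfl⟩ := wordSpan_zero_subset_range hx
      rw [hsucc, ← inner_compression, ← inner_compression, hV.compression_map hT hφV]
      change ⟪y, φT (compression J (extendByZero J C)) y⟫_ℂ
        = ⟪y, compression J (extendByZero J C) y⟫_ℂ
      rw [compression_extendByZero, hC]
    | succ n ih =>
      rw [hsucc (n + 1)]
      nth_rw 2 [hsucc n]
      exact hV.inner_map_eq_of_eq_on_wordSpan (n := n + 1) hφV ih
  obtain ⟨L, hL0, hLN, hL⟩ := exists_limit_of_eq_on_wordSpan (norm_nonneg C) h0 hN hagree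
  have hfix : ∀ n, ∀ x ∈ wordSpan J V n, ⟪x, φV L x⟫_ℂ = ⟪x, L x⟫_ℂ := fun n x hx => by
    rw [hL n x hx, ← hagree n x hx, hsucc]
    exact hV.inner_map_eq_of_eq_on_wordSpan hφV
      (fun z hz => hL n z (wordSpan_mono (Nat.sub_le _ _) hz)) x hx
  have hcomp : C = compression J L := eq_compression_of_eq_on_wordSpan (hL 0)
  refine ⟨L, hL0, le_antisymm (hV.le_of_le_on_wordSpan fun n x hx => (hfix n x hx).le)
    (hV.le_of_le_on_wordSpan fun n x hx => (hfix n x hx).ge), hcomp, le_antisymm ?_ ?_⟩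
  · rw [hcomp]
    exact norm_compression_le L
  · exact (opNorm_le_iff_le_algebraMap hL0 (norm_nonneg C)).2 hLN

/-- Iterating `φV` could lower the compression, so each step interpolates instead. The invariant `P
n` asks for the inequality on K_n only. -/
theorem exists_solution_of_solution (hT : IsDeterminedBy φT T) (hφV : IsDeterminedBy φV V)
    {C : H →L[ℂ] H} (hC0 : 0 ≤ C) (hC : φT C ≤ C) :
    ∃ D : K →L[ℂ] K, 0 ≤ D ∧ φV D ≤ D ∧ C = compression J D ∧ ‖C‖ = ‖D‖ := by
  let P : ℕ → (K →L[ℂ] K) → Prop := fun n D => 0 ≤ D ∧ D ≤ algebraMap ℝ (K →L[ℂ] K) ‖C‖ ∧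
    ∀ x ∈ wordSpan J V n, ⟪x, φV D x⟫_ℂ ≤ ⟪x, D x⟫_ℂ
  have hstep : ∀ n D, P n D → ∃ D', P (n + 1) D' ∧ φV D ≤ D' ∧
      ∀ x ∈ wordSpan J V n, ⟪x, D' x⟫_ℂ = ⟪x, D x⟫_ℂ := by
    rintro n D ⟨h0, hN, hD⟩
    obtain ⟨D', h1, h2, h3⟩ := exists_between_eq_on (wordSpan J V n) (isClosed_wordSpan n)
      (hV.map_le_algebraMap hφV (norm_nonneg C) hN) hD hN
    refine ⟨D', ⟨(hφV.map_nonneg h0).trans h1, h2, fun x hx => ?_⟩, h1, h3⟩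
    -- On K_(n+1), `φV D'` has the form of `φV D`, since `D'` and `D` agree on K_n; and `φV D ≤ D'`
    -- by construction.
    rw [hV.inner_map_eq_of_eq_on_wordSpan (n := n + 1) hφV h3 x hx]
    exact loewner_le_iff.1 h1 x
  have hzero : P 0 (extendByZero J C) := by
    refine ⟨extendByZero_nonneg hC0, extendByZero_le_algebraMap hC0, fun x hx => ?_⟩
    obtain ⟨y, rfl⟩ := wordSpan_zero_subset_range hx
    rw [← inner_compression, ← inner_compression, hV.compression_map hT hφV,
      compression_extendByZero]
    exact loewner_le_iff.1 hC y
  choose! next hnext _ hagree using hstep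
  let D : ℕ → K →L[ℂ] K := fun n => Nat.rec (extendByZero J C) next n
  have hP : ∀ n, P n (D n) := fun n => by
    induction n with
    | zero => exact hzero
    | succ n ih => exact hnext n _ ih
  obtain ⟨L, hL0, hLN, hL⟩ := exists_limit_of_eq_on_wordSpan (norm_nonneg C)
    (fun n => (hP n).1) (fun n => (hP n).2.1) (fun n => hagree n _ (hP n))
  have hcomp : C = compression J L := eq_compression_of_eq_on_wordSpan (hL 0)
  refine ⟨L, hL0, hV.le_of_le_on_wordSpan fun n x hx => ?_, hcomp, le_antisymm ?_ ?_⟩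
  · rw [hL n x hx, hV.inner_map_eq_of_eq_on_wordSpan hφV
      (fun z hz => hL n z (wordSpan_mono (Nat.sub_le _ _) hz)) x hx]
    exact (hP n).2.2 x hx
  · rw [hcomp]
    exact norm_compression_le L
  · exact (opNorm_le_iff_le_algebraMap hL0 (norm_nonneg C)).2 hLN

theorem iterate_map_word (hφV : IsDeterminedBy φV V) (D : K →L[ℂ] K) (α : List ι) (k : ℕ)
    (x : K) : φV^[k + α.length] D ((α.map V).prod x) = (α.map V).prod (φV^[k] D x) := by
  induction α with
  | nil => simp
  | cons j β ih =>
    rw [List.map_cons, List.prod_cons, mul_apply_eq_comp, mul_apply_eq_comp, List.length_cons,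
      ← add_assoc, Function.iterate_succ_apply', hV.map_apply_apply hφV, ih]

/-- On H, the forms of the iterates of `D` are those of the iterates of `C`, so positivity gives
strong convergence there. Words and the uniform bound ‖D‖ spread it to all of K. -/
theorem isPureSolution_of_compression (hT : IsDeterminedBy φT T) (hφV : IsDeterminedBy φV V)
    {D : K →L[ℂ] K} (hD0 : 0 ≤ D) (hD : φV D ≤ D) (hC : IsPureSolution φT (compression J D)) :
    IsPureSolution φV D := by
  have h0 := hφV.iterate_nonneg hD0
  have hN : ∀ k, ‖φV^[k] D‖ ≤ ‖D‖ := fun k =>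
    CStarAlgebra.norm_le_norm_of_nonneg_of_le (h0 k)
      (hφV.monotone.antitone_iterate_of_map_le hD (Nat.zero_le k))
  have hJ : ∀ h : H, Tendsto (fun k => φV^[k] D (J h)) atTop (𝓝 0) := fun h => by
    refine tendsto_apply_zero_of_tendsto_inner_self h0 hN ?_
    simp_rw [← inner_compression, hV.compression_iterate hT hφV]
    simpa using (tendsto_const_nhds (x := h)).inner (𝕜 := ℂ) (hC.2 h)
  refine ⟨hD, tendsto_zero_of_dense_span hN hV.minimal ?_⟩
  rintro _ ⟨α, h, rfl⟩
  -- Shifting by the word length lets the whole word be pulled out of the iterate.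
  rw [← tendsto_add_atTop_iff_nat α.length]
  simp_rw [hV.iterate_map_word hφV]
  simpa [Function.comp_def] using (((α.map V).prod.continuous.tendsto 0).comp (hJ h))

theorem isPureSolution_compression (hT : IsDeterminedBy φT T) (hφV : IsDeterminedBy φV V)
    {D : K →L[ℂ] K} (hD : IsPureSolution φV D) : IsPureSolution φT (compression J D) := by
  refine ⟨?_, fun h => ?_⟩
  · rw [← hV.compression_map hT hφV]
    exact compression_mono hD.1
  · simp_rw [← hV.compression_iterate hT hφV]
    simpa [compression, Function.comp_def] using
      (((J.toContinuousLinearMap)†).continuous.tendsto 0).comp (hD.2 (J h))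

end IsMinimalIsometricDilation

/-- The iterates decrease from `C` to 0, so `C` dominates their limit; this supplies the positivity
that the lifting needs. -/
theorem IsPureSolution.nonneg {E ι : Type*} [NormedAddCommGroup E] [InnerProductSpace ℂ E]
    [CompleteSpace E] {φ : (E →L[ℂ] E) → (E →L[ℂ] E)} {A : ι → (E →L[ℂ] E)}
    (hφ : IsDeterminedBy φ A) {C : E →L[ℂ] E} (hC : IsPureSolution φ C) : 0 ≤ C := by
  rw [loewner_nonneg_iff]
  intro x
  have h := (tendsto_const_nhds (x := x)).inner (𝕜 := ℂ) (hC.2 x)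
  rw [inner_zero_right] at h
  exact le_of_tendsto' h fun k => loewner_le_iff.1
    (hφ.monotone.antitone_iterate_of_map_le hC.1 (Nat.zero_le k)) x

/-- The family `T` (finite or infinite) determines the `w*`-continuous completely positive map
`φT`, and `φV` is the map determined by the minimal isometric dilation `V` of `T`. -/
theorem theorem3p5 {H K ι : Type*}
    [NormedAddCommGroup H] [InnerProductSpace ℂ H] [CompleteSpace H]
    [TopologicalSpace.SeparableSpace H]
    [NormedAddCommGroup K] [InnerProductSpace ℂ K] [CompleteSpace K]
    [Countable ι]
    (φT : (H →L[ℂ] H) →CP (H →L[ℂ] H)) (hφT : IsWeakStarContinuous φT)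
    (T : ι → (H →L[ℂ] H)) (hT : IsDeterminedBy φT T) (hφT_one : φT 1 ≤ 1)
    (J : H →ₗᵢ[ℂ] K) (V : ι → (K →L[ℂ] K)) (hV : IsMinimalIsometricDilation T J V)
    (φV : (K →L[ℂ] K) →ₗ[ℂ] (K →L[ℂ] K)) (hφV : IsDeterminedBy φV V) :
    (∀ C : H →L[ℂ] H, 0 ≤ C →
      (φT C ≤ C ↔
        ∃ D : K →L[ℂ] K, 0 ≤ D ∧ φV D ≤ D ∧ C = compression J D ∧ ‖C‖ = ‖D‖) ∧
      (φT C = C ↔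
        ∃ D : K →L[ℂ] K, 0 ≤ D ∧ φV D = D ∧ C = compression J D ∧ ‖C‖ = ‖D‖)) ∧
    (∀ C : H →L[ℂ] H,
      IsPureSolution φT C ↔
        ∃ D : K →L[ℂ] K, IsPureSolution φV D ∧ C = compression J D ∧ ‖C‖ = ‖D‖) := by
  refine ⟨fun C hC0 => ⟨⟨hV.exists_solution_of_solution hT hφV hC0, ?_⟩,
    ⟨hV.exists_fixed_of_fixed hT hφV hC0, ?_⟩⟩, fun C => ⟨fun hC => ?_, ?_⟩⟩
  · rintro ⟨D, -, hD, rfl, -⟩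
    rw [← hV.compression_map hT hφV]
    exact compression_mono hD
  · rintro ⟨D, -, hD, rfl, -⟩
    rw [← hV.compression_map hT hφV, hD]
  · obtain ⟨D, hD0, hD, hCD, hnorm⟩ :=
      hV.exists_solution_of_solution hT hφV (IsPureSolution.nonneg hT hC) hC.1
    exact ⟨D, hV.isPureSolution_of_compression hT hφV hD0 hD (hCD ▸ hC), hCD, hnorm⟩
  · rintro ⟨D, hD, rfl, -⟩
    exact hV.isPureSolution_compression hT hφV hD
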